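/- Let $G$ be a countable group. A \emph{system} is a measure-preserving action of $G$ on a standard Borel probability space (atoms are allowed, ergodicity is not required). A \emph{factor} of a system is the restriction of the action to an invariant sub-$\sigma$-algebra; equivalently it is given, up to isomorphism, by a measure-preserving, almost everywhere equivariant map onto another system. Systems, factors and $\sigma$-algebras are considered up to null sets, and a property of systems is understood to be invariant under isomorphism. A factor is \emph{nontrivial} if its $\sigma$-algebra contains a set whose measure is neither $0$ nor $1$. A property of systems is \emph{hereditarily stable} if (i) every factor of a system with the property has the property, and (ii) every system whose $\sigma$-algebra is generated, up to null sets, by a family of factors having the property has the property itself. Two systems $S$ on $(X,\mu)$ and $T$ on $(Y,\nu)$ are \emph{disjoint} if $\mu\times\nu$ is their only joining, i.e. the only measure on $X\times Y$ that is invariant under the diagonal action of $G$ and has marginals $\mu$ and $\nu$. \textbf{Theorem.} Let $S$ be a system that has some hereditarily stable property, and let $T$ be a system such that neither $T$ nor any nontrivial factor of $T$ has this property. Then $S$ and $T$ are disjoint. -/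

import Mathlib

open MeasureTheory
open scoped MeasureTheory

universe u v

/-- A measure-preserving action of the group `G` on a standard probability space:
a standard Borel space with a probability measure (atoms allowed, ergodicity not required),
on which every group element acts by a measurable measure-preserving transformation. -/
structure MPSystem (G : Type u) [Group G] where
  X : Type v
  [measurableSpace : MeasurableSpace X]
  [standardBorel : StandardBorelSpace X]
  μ : Measure X
  [isProbability : IsProbabilityMeasure μ]
  [action : MulAction G X]
  measurePreserving : ∀ g : G, MeasurePreserving (fun x : X => g • x) μ μ

namespace MPSystem

attribute [instance] MPSystem.measurableSpace MPSystem.standardBorel MPSystem.isProbability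
  MPSystem.action

variable {G : Type u} [Group G]

/-- Up to null sets, every set of the sigma-algebra `𝓐` belongs to the sigma-algebra `𝓑`. -/
def AELe (S : MPSystem.{u, v} G) (𝓐 𝓑 : MeasurableSpace S.X) : Prop :=
  ∀ A : Set S.X, MeasurableSet[𝓐] A → ∃ B : Set S.X, MeasurableSet[𝓑] B ∧ A =ᵐ[S.μ] B

/-- `𝓐` is an invariant sub-sigma-algebra of the action `S` (invariance being understood, as
everything in measure theory, up to null sets). The factors of `S` are the restrictions of the
action to such sigma-algebras. -/
structure IsInvariant (S : MPSystem.{u, v} G) (𝓐 : MeasurableSpace S.X) : Prop where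
  le : 𝓐 ≤ S.measurableSpace
  preimage : ∀ (g : G) (A : Set S.X), MeasurableSet[𝓐] A →
    ∃ B : Set S.X, MeasurableSet[𝓐] B ∧ (fun x : S.X => g • x) ⁻¹' A =ᵐ[S.μ] B

/-- `π` is a factor map from `S` to `F`: it is measure-preserving and almost everywhere
equivariant. -/
structure IsFactorMap (S F : MPSystem.{u, v} G) (π : S.X → F.X) : Prop where
  measurePreserving : MeasurePreserving π S.μ F.μ
  equivariant : ∀ g : G, ∀ᵐ x ∂S.μ, π (g • x) = g • π x

/-- The system `F` is (isomorphic to) the factor of `S` given by the sigma-algebra `𝓐`: there is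
a factor map `π : S → F` such that the sigma-algebra of the `π`-preimages of measurable sets
coincides with `𝓐` up to null sets. -/
def IsFactorOn (F S : MPSystem.{u, v} G) (𝓐 : MeasurableSpace S.X) : Prop :=
  ∃ π : S.X → F.X, S.IsFactorMap F π ∧
    S.AELe 𝓐 (F.measurableSpace.comap π) ∧ S.AELe (F.measurableSpace.comap π) 𝓐

/-- The factor of `S` given by `𝓐` is nontrivial. -/
def IsNontrivialOn (S : MPSystem.{u, v} G) (𝓐 : MeasurableSpace S.X) : Prop :=
  ∃ A : Set S.X, MeasurableSet[𝓐] A ∧ S.μ A ≠ 0 ∧ S.μ A ≠ 1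

/-- A property `P` of systems is inherited by factors. Since the factor is taken up to
isomorphism, this includes invariance of `P` under isomorphism (`𝓐` the whole
sigma-algebra). -/
def InheritedByFactors (P : MPSystem.{u, v} G → Prop) : Prop :=
  ∀ (S F : MPSystem.{u, v} G) (𝓐 : MeasurableSpace S.X),
    S.IsInvariant 𝓐 → F.IsFactorOn S 𝓐 → P S → P F

/-- A property `P` of systems is inherited by every system that is generated (up to null sets) by
some family of factors having the property. -/
def InheritedByGenerated (P : MPSystem.{u, v} G → Prop) : Prop :=
  ∀ (S : MPSystem.{u, v} G) (𝒜 : Set (MeasurableSpace S.X)),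
    (∀ 𝓐 ∈ 𝒜, S.IsInvariant 𝓐 ∧ ∃ F : MPSystem.{u, v} G, F.IsFactorOn S 𝓐 ∧ P F) →
    S.AELe S.measurableSpace (sSup 𝒜) → P S

/-- Hereditarily stable properties of systems. -/
structure HereditarilyStable (P : MPSystem.{u, v} G → Prop) : Prop where
  factors : InheritedByFactors P
  generated : InheritedByGenerated P

/-- A joining of `S` and `T`: a measure on the product, invariant under the diagonal action, whose
marginals are the measures of `S` and `T`. -/
structure IsJoining (S T : MPSystem.{u, v} G) (ν : Measure (S.X × T.X)) : Prop where
  map_fst : ν.map Prod.fst = S.μ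
  map_snd : ν.map Prod.snd = T.μ
  invariant : ∀ g : G, ν.map (fun p : S.X × T.X => (g • p.1, g • p.2)) = ν

/-- Two systems are disjoint if the product measure is their only joining. -/
def Disjoint (S T : MPSystem.{u, v} G) : Prop :=
  ∀ ν : Measure (S.X × T.X), S.IsJoining T ν → ν = S.μ.prod T.μ

end MPSystem

/-!
A joining of `T` and `S` is the same as an equivariant Markov kernel `κ` from `T` to `S`. Sampling
i.i.d. points from `κ y` produces an infinite self-joining of `S`; it is generated by copies of `S`,
so it has the property. By the law of large numbers the averages of `1_A` along the sample recover
`κ y A`. Hence the factor of `T` generated by `y ↦ κ y A` is also a factor of the self-joining, and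
as such has the property; it must be trivial. Thus every `κ y A` is almost surely constant in `y`,
which means that the joining is the product.
-/

open ProbabilityTheory Filter

section Kernel

variable {X X' Y Y' : Type*} [MeasurableSpace X] [MeasurableSpace X'] [MeasurableSpace Y]
  [MeasurableSpace Y'] {m : Measure Y} {m' : Measure Y'}

lemma measurePreserving_comp_of_ae_map_eq {κ : Kernel Y X} {κ' : Kernel Y' X'} {e : Y → Y'}
    {h : X → X'} (he : MeasurePreserving e m m') (hh : Measurable h)
    (hκ : ∀ᵐ y ∂m, (κ y).map h = κ' (e y)) : MeasurePreserving h (κ ∘ₘ m) (κ' ∘ₘ m') := by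
  refine ⟨hh, ?_⟩
  have hmap : ∀ᵐ y ∂m, κ.map h y = κ'.comap e he.measurable y := by
    simpa only [Kernel.map_apply _ hh, Kernel.comap_apply] using hκ
  rw [Measure.map_comp m κ hh, Measure.comp_congr hmap, ← Kernel.comp_deterministic_eq_comap,
    ← Measure.comp_assoc, Measure.deterministic_comp_eq_map, he.map_eq]

lemma map_prodMap_id_compProd_comap [SFinite m] (κ : Kernel Y' X) [IsSFiniteKernel κ]
    {e : Y → Y'} (he : MeasurePreserving e m m') :
    (m ⊗ₘ κ.comap e he.measurable).map (Prod.map e id) = m' ⊗ₘ κ := by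
  have : SFinite m' := he.map_eq ▸ inferInstance
  have hmeas : Measurable (Prod.map e (id : X → X)) := he.measurable.prodMap measurable_id
  rw [Measure.compProd_eq_comp_prod, Measure.compProd_eq_comp_prod]
  refine (measurePreserving_comp_of_ae_map_eq he hmeas (ae_of_all _ fun y => ?_)).map_eq
  rw [Kernel.prod_apply, Kernel.prod_apply, Kernel.comap_apply, Kernel.id_apply, Kernel.id_apply,
    ← Measure.map_prod_map _ _ he.measurable measurable_id, Measure.map_dirac' he.measurable,
    Measure.map_id]

lemma ae_map_eq_of_map_prodMap_compProd_eq [IsFiniteMeasure m]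
    [MeasurableSpace.CountableOrCountablyGenerated Y X'] {κ : Kernel Y X} [IsFiniteKernel κ]
    {κ' : Kernel Y' X'} [IsFiniteKernel κ'] {e : Y ≃ᵐ Y'} (he : MeasurePreserving e m m')
    {h : X → X'} (hh : Measurable h) (hκ : (m ⊗ₘ κ).map (Prod.map e h) = m' ⊗ₘ κ') :
    ∀ᵐ y ∂m, (κ y).map h = κ' (e y) := by
  have hcompProd : m ⊗ₘ κ.map h = m ⊗ₘ κ'.comap e he.measurable := by
    refine (e.prodCongr (.refl X')).map_measurableEquiv_injective ?_
    change (m ⊗ₘ κ.map h).map (Prod.map e id) =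
      (m ⊗ₘ κ'.comap e he.measurable).map (Prod.map e id)
    rw [map_prodMap_id_compProd_comap κ' he, Measure.compProd_map hh, ← hκ,
      Measure.map_map (e.measurable.prodMap measurable_id) (measurable_id.prodMap hh),
      Prod.map_comp_map, Function.comp_id, Function.id_comp]
  filter_upwards [Kernel.ae_eq_of_compProd_eq hcompProd] with y hy
  rwa [Kernel.map_apply _ hh, Kernel.comap_apply] at hy

lemma compProd_eq_prod_of_ae_eq_const [IsProbabilityMeasure m] {κ : Kernel Y X} [IsMarkovKernel κ]
    (hκ : ∀ A, MeasurableSet A → ∃ c, ∀ᵐ y ∂m, κ y A = c) :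
    m ⊗ₘ κ = m.prod (κ ∘ₘ m) := by
  refine Measure.ext_prod fun {B A} hB hA => ?_
  obtain ⟨c, hc⟩ := hκ A hA
  rw [Measure.compProd_apply_prod hB hA, Measure.prod_prod, Measure.bind_apply hA κ.aemeasurable,
    lintegral_congr_ae hc, lintegral_congr_ae (ae_restrict_of_ae hc), setLIntegral_const,
    lintegral_const, measure_univ, mul_one, mul_comm]

lemma measurable_integral_kernel (κ : Kernel Y X) {f : X → ℝ} (hf : Measurable f) :
    Measurable fun y => ∫ x, f x ∂κ y :=
  hf.stronglyMeasurable.integral_kernel.measurable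

/-- The product kernel `y ↦ ⨂ i, κ i y` of a family of Markov kernels. -/
noncomputable def infinitePiKernel {ι : Type*} {X : ι → Type*} [∀ i, MeasurableSpace (X i)]
    (κ : ∀ i, Kernel Y (X i)) [∀ i, IsMarkovKernel (κ i)] : Kernel Y (∀ i, X i) where
  toFun y := Measure.infinitePi fun i => κ i y
  measurable' := by
    refine .measure_of_isPiSystem_of_isProbabilityMeasure generateFrom_squareCylinders.symm
      (isPiSystem_squareCylinders (fun _ => MeasurableSpace.isPiSystem_measurableSet)
        fun _ => .univ) ?_
    rintro _ ⟨s, t, ht, rfl⟩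
    have ht' : ∀ i, MeasurableSet (t i) := fun i => ht i (Set.mem_univ i)
    simp only [Measure.infinitePi_pi _ fun i _ => ht' i]
    exact Finset.measurable_prod _ fun i _ => (κ i).measurable_coe (ht' i)

instance {ι : Type*} {X : ι → Type*} [∀ i, MeasurableSpace (X i)]
    (κ : ∀ i, Kernel Y (X i)) [∀ i, IsMarkovKernel (κ i)] : IsMarkovKernel (infinitePiKernel κ) :=
  ⟨fun y => inferInstanceAs (IsProbabilityMeasure (Measure.infinitePi fun i => κ i y))⟩

end Kernel

section UpperAverage

variable {X : Type*} [MeasurableSpace X]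

/-- The upper limit of the averages of `f` along a sequence. A limsup is used because it is
defined and measurable on all sequences. -/
noncomputable def upperAverage (f : X → ℝ) (x : ℕ → X) : ℝ :=
  limsup (fun n : ℕ => (∑ i ∈ Finset.range n, f (x i)) / n) atTop

lemma measurable_upperAverage {f : X → ℝ} (hf : Measurable f) : Measurable (upperAverage f) :=
  .limsup fun n => by fun_prop

lemma ae_upperAverage_eq_integral (p : Measure X) [IsProbabilityMeasure p] {f : X → ℝ}
    (hf : Measurable f) (hfp : Integrable f p) :
    ∀ᵐ x ∂Measure.infinitePi (fun _ : ℕ => p), upperAverage f x = ∫ a, f a ∂p := by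
  have heval (i : ℕ) : MeasurePreserving (Function.eval i) (Measure.infinitePi fun _ : ℕ => p) p :=
    measurePreserving_eval_infinitePi _ i
  have hident (i : ℕ) : IdentDistrib (fun x : ℕ → X => f (x i)) (fun x => f (x 0))
      (Measure.infinitePi fun _ => p) (Measure.infinitePi fun _ => p) :=
    IdentDistrib.comp ⟨(heval i).aemeasurable, (heval 0).aemeasurable,
      (heval i).map_eq.trans (heval 0).map_eq.symm⟩ hf
  have hmean : ∫ x, f (x 0) ∂Measure.infinitePi (fun _ : ℕ => p) = ∫ a, f a ∂p := by
    conv_rhs => rw [← (heval 0).map_eq]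
    exact (integral_map (heval 0).aemeasurable hf.aestronglyMeasurable).symm
  filter_upwards [strong_law_ae_real _ ((heval 0).integrable_comp_of_integrable hfp)
    (fun i j hij => (iIndepFun_infinitePi fun _ => hf).indepFun hij) hident] with x hx
  exact hx.limsup_eq.trans hmean

end UpperAverage

namespace MPSystem

variable {G : Type u} [Group G]

instance (S : MPSystem.{u, v} G) : MeasurableConstSMul G S.X :=
  ⟨fun g => (S.measurePreserving g).measurable⟩

section FactorMap

variable {S F : MPSystem.{u, v} G} {π : S.X → F.X}

lemma IsFactorMap.isInvariant (h : S.IsFactorMap F π) :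
    S.IsInvariant (F.measurableSpace.comap π) where
  le := h.measurePreserving.measurable.comap_le
  preimage := by
    rintro g _ ⟨B, hB, rfl⟩
    refine ⟨π ⁻¹' ((g • ·) ⁻¹' B), ⟨_, hB.preimage (measurable_const_smul g), rfl⟩, ?_⟩
    filter_upwards [h.equivariant g] with x hx
    exact congrArg (· ∈ B) hx

lemma IsFactorMap.isFactorOn (h : S.IsFactorMap F π) :
    F.IsFactorOn S (F.measurableSpace.comap π) :=
  ⟨π, h, fun A hA => ⟨A, hA, ae_eq_rfl⟩, fun A hA => ⟨A, hA, ae_eq_rfl⟩⟩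

lemma InheritedByFactors.of_isFactorMap {P : MPSystem.{u, v} G → Prop}
    (hP : InheritedByFactors P) (h : S.IsFactorMap F π) (hS : P S) : P F :=
  hP S F _ h.isInvariant h.isFactorOn hS

lemma exists_ae_eq_const_of_not_isNontrivialOn {𝓐 : MeasurableSpace S.X}
    (h𝓐 : 𝓐 ≤ S.measurableSpace) (htriv : ¬ S.IsNontrivialOn 𝓐) {E : Type*} [Nonempty E]
    [MeasurableSpace E] [MeasurableSpace.CountablySeparated E] {f : S.X → E}
    (hf : Measurable[𝓐] f) : ∃ c, f =ᵐ[S.μ] Function.const _ c := by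
  refine exists_eventuallyEq_const_of_forall_separating MeasurableSet fun U hU => ?_
  have hzero_or_one : S.μ (f ⁻¹' U) = 0 ∨ S.μ (f ⁻¹' U) = 1 := by
    by_contra! hne
    exact htriv ⟨f ⁻¹' U, hf hU, hne⟩
  rcases hzero_or_one with hzero | hone
  · exact .inr (measure_eq_zero_iff_ae_notMem.1 hzero)
  · exact .inl ((mem_ae_iff_prob_eq_one (h𝓐 _ (hf hU))).2 hone)

end FactorMap

section OrbitSystem

attribute [local instance] arrowAction

variable {E : Type}

/-- The values `k ↦ f (k⁻¹ • x)` of `f` along the orbit of `x`. The group is replaced by its copy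
in the universe of the phase spaces; the inverse makes the map equivariant for the action by
translation on functions. -/
noncomputable def orbitMap [Small.{v} G] (S : MPSystem.{u, v} G) (f : S.X → E) (x : S.X) :
    Shrink.{v} G → E :=
  fun k => f (((equivShrink G).symm k)⁻¹ • x)

variable {S T : MPSystem.{u, v} G}

lemma orbitMap_smul [Small.{v} G] (f : S.X → E) (g : G) (x : S.X) :
    S.orbitMap f (g • x) = g • S.orbitMap f x := by
  funext k
  change f (_ • g • x) = f (((equivShrink G).symm (g⁻¹ • k))⁻¹ • x)
  rw [equivShrink_symm_smul, smul_eq_mul, mul_inv_rev, inv_inv, mul_smul]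

variable [MeasurableSpace E]

lemma measurable_orbitMap [Small.{v} G] {f : S.X → E} (hf : Measurable f) :
    Measurable (S.orbitMap f) :=
  measurable_pi_lambda _ fun _ => hf.comp (measurable_const_smul _)

lemma measurable_comap_orbitMap [Small.{v} G] (f : S.X → E) :
    Measurable[MeasurableSpace.pi.comap (S.orbitMap f)] f := by
  have heval : f = (fun φ => φ (equivShrink G 1)) ∘ S.orbitMap f := by
    funext x
    simp [orbitMap]
  conv_rhs => rw [heval]
  exact (measurable_pi_apply _).comp (comap_measurable _)

variable [Countable G] [StandardBorelSpace E]

/-- The factor of `T` generated by the translates of `f`, realized on the functions on `G`. The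
values of `f` lie in a `Type` so that these functions live in the universe of the phase spaces. -/
noncomputable abbrev orbitSystem (T : MPSystem.{u, v} G) {f : T.X → E} (hf : Measurable f) :
    MPSystem.{u, v} G where
  X := Shrink.{v} G → E
  standardBorel :=
    have : Countable (Shrink.{v} G) := .of_equiv G (equivShrink.{v} G)
    inferInstance
  μ := T.μ.map (T.orbitMap f)
  isProbability := Measure.isProbabilityMeasure_map (measurable_orbitMap hf).aemeasurable
  measurePreserving g := by
    have hshift : Measurable (g • · : (Shrink.{v} G → E) → Shrink.{v} G → E) :=
      measurable_pi_lambda _ fun k => measurable_pi_apply (g⁻¹ • k)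
    exact .of_semiconj (f := T.orbitMap f) ⟨measurable_orbitMap hf, rfl⟩ (T.measurePreserving g)
      (orbitMap_smul f g) hshift

lemma isFactorMap_orbitMap {f : T.X → E} (hf : Measurable f) {e : S.X → E}
    (he : MeasurePreserving (S.orbitMap e) S.μ (T.μ.map (T.orbitMap f))) :
    S.IsFactorMap (T.orbitSystem hf) (S.orbitMap e) where
  measurePreserving := he
  equivariant g := ae_of_all _ fun x => orbitMap_smul e g x

lemma isFactorMap_orbitSystem {f : T.X → E} (hf : Measurable f) :
    T.IsFactorMap (T.orbitSystem hf) (T.orbitMap f) :=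
  isFactorMap_orbitMap hf ⟨measurable_orbitMap hf, rfl⟩

end OrbitSystem

section EquivariantKernel

/-- A kernel from `T` to `S` is equivariant if it averages to the measure of `S` and intertwines
the actions almost everywhere. The joinings of `T` and `S` are the measures `T.μ ⊗ₘ κ` for these
kernels. -/
structure IsEquivariantKernel (T S : MPSystem.{u, v} G) (κ : Kernel T.X S.X) : Prop where
  comp_eq : κ ∘ₘ T.μ = S.μ
  equivariant : ∀ g : G, ∀ᵐ y ∂T.μ, (κ y).map (g • ·) = κ (g • y)

variable {S T : MPSystem.{u, v} G} {κ : Kernel T.X S.X} [IsMarkovKernel κ]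

lemma IsEquivariantKernel.map_infinitePiKernel (h : T.IsEquivariantKernel S κ) (g : G) :
    ∀ᵐ y ∂T.μ, (infinitePiKernel (fun _ : ℕ => κ) y).map (g • ·) =
      infinitePiKernel (fun _ : ℕ => κ) (g • y) := by
  filter_upwards [h.equivariant g] with y hy
  simp only [infinitePiKernel, Kernel.coe_mk, ← hy]
  exact Measure.infinitePi_map_pi (fun _ : ℕ => κ y) fun _ => measurable_const_smul g

/-- The relatively independent self-joining of countably many copies of `S` over `T`, given
`y : T.X` by i.i.d. points of law `κ y`. -/
noncomputable abbrev powerSystem (h : T.IsEquivariantKernel S κ) : MPSystem.{u, v} G where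
  X := ℕ → S.X
  μ := infinitePiKernel (fun _ : ℕ => κ) ∘ₘ T.μ
  measurePreserving g := measurePreserving_comp_of_ae_map_eq (T.measurePreserving g)
    (measurable_const_smul g) (h.map_infinitePiKernel g)

lemma isFactorMap_eval_powerSystem (h : T.IsEquivariantKernel S κ) (i : ℕ) :
    (powerSystem h).IsFactorMap S (Function.eval i) where
  measurePreserving := by
    have heval := measurePreserving_comp_of_ae_map_eq (κ := infinitePiKernel fun _ : ℕ => κ)
      (.id T.μ) (measurable_pi_apply i)
      (ae_of_all _ fun y => Measure.infinitePi_map_eval (fun _ : ℕ => κ y) i)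
    rwa [h.comp_eq] at heval
  equivariant _ := ae_of_all _ fun _ => rfl

lemma InheritedByGenerated.powerSystem {P : MPSystem.{u, v} G → Prop}
    (hP : InheritedByGenerated P) (hS : P S) (h : T.IsEquivariantKernel S κ) :
    P (powerSystem h) := by
  refine hP _ (Set.range fun i : ℕ => S.measurableSpace.comap (Function.eval i)) ?_ fun A hA =>
    ⟨A, ?_, ae_eq_rfl⟩
  · rintro _ ⟨i, rfl⟩
    have hi := isFactorMap_eval_powerSystem h i
    exact ⟨hi.isInvariant, S, hi.isFactorOn, hS⟩
  · rwa [sSup_range]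

lemma IsEquivariantKernel.ae_orbitMap_upperAverage_eq [Countable G]
    (h : T.IsEquivariantKernel S κ) {f : S.X → ℝ} (hf : Measurable f) (hfi : Integrable f S.μ) :
    ∀ᵐ y ∂T.μ, ∀ᵐ x ∂infinitePiKernel (fun _ : ℕ => κ) y,
      (powerSystem h).orbitMap (upperAverage f) x = T.orbitMap (fun y => ∫ a, f a ∂κ y) y := by
  have hint (g : G) : ∀ᵐ y ∂T.μ, Integrable f (κ (g • y)) :=
    (T.measurePreserving g).quasiMeasurePreserving.ae
      (Measure.ae_integrable_of_integrable_comp (h.comp_eq ▸ hfi))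
  filter_upwards [ae_all_iff.2 hint, ae_all_iff.2 h.map_infinitePiKernel] with y hinty hmap
  have hfreq (g : G) : ∀ᵐ x ∂infinitePiKernel (fun _ : ℕ => κ) y,
      upperAverage f (g • x) = ∫ a, f a ∂κ (g • y) := by
    have hlaw : ∀ᵐ x ∂(infinitePiKernel (fun _ : ℕ => κ) y).map (g • ·),
        upperAverage f x = ∫ a, f a ∂κ (g • y) := by
      rw [hmap g]
      exact ae_upperAverage_eq_integral (κ (g • y)) hf (hinty g)
    exact ae_of_ae_map (measurable_const_smul g).aemeasurable hlaw
  filter_upwards [ae_all_iff.2 hfreq] with x hx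
  exact funext fun k => hx _

lemma IsEquivariantKernel.measurePreserving_orbitMap_upperAverage [Countable G]
    (h : T.IsEquivariantKernel S κ) {f : S.X → ℝ} (hf : Measurable f) (hfi : Integrable f S.μ) :
    MeasurePreserving ((powerSystem h).orbitMap (upperAverage f)) (powerSystem h).μ
      (T.μ.map (T.orbitMap fun y => ∫ a, f a ∂κ y)) := by
  have hmeas := measurable_orbitMap (S := T) (measurable_integral_kernel κ hf)
  have hcomp := measurePreserving_comp_of_ae_map_eq (κ := infinitePiKernel fun _ : ℕ => κ)
    (κ' := Kernel.id) (m := T.μ) ⟨hmeas, rfl⟩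
    (measurable_orbitMap (S := powerSystem h) (measurable_upperAverage hf)) (by
      filter_upwards [h.ae_orbitMap_upperAverage_eq hf hfi] with y hy
      rw [Measure.map_congr hy, Measure.map_const, measure_univ, one_smul, Kernel.id_apply])
  rwa [Measure.id_comp] at hcomp

lemma HereditarilyStable.orbitSystem_integral [Countable G] {P : MPSystem.{u, v} G → Prop}
    (hP : HereditarilyStable P) (hS : P S) (h : T.IsEquivariantKernel S κ) {f : S.X → ℝ}
    (hf : Measurable f) (hfi : Integrable f S.μ) :
    P (T.orbitSystem (measurable_integral_kernel κ hf)) :=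
  hP.factors.of_isFactorMap
    (isFactorMap_orbitMap _ (h.measurePreserving_orbitMap_upperAverage hf hfi))
    (hP.generated.powerSystem hS h)

end EquivariantKernel

section Joining

variable {S T : MPSystem.{u, v} G}

lemma IsJoining.symm {ν : Measure (S.X × T.X)} (hν : S.IsJoining T ν) :
    T.IsJoining S (ν.map Prod.swap) where
  map_fst := by
    rw [Measure.map_map measurable_fst measurable_swap, ← hν.map_snd]
    rfl
  map_snd := by
    rw [Measure.map_map measurable_snd measurable_swap, ← hν.map_fst]
    rfl
  invariant g := by
    have hg : Measurable fun p : S.X × T.X => (g • p.1, g • p.2) := by fun_prop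
    conv_rhs => rw [← hν.invariant g, Measure.map_map measurable_swap hg]
    exact Measure.map_map (by fun_prop) measurable_swap

lemma Disjoint.symm (h : S.Disjoint T) : T.Disjoint S := by
  intro ν hν
  rw [← Measure.prod_swap, ← h _ hν.symm, Measure.map_map measurable_swap measurable_swap,
    Prod.swap_swap_eq, Measure.map_id]

lemma IsJoining.isProbabilityMeasure {ν : Measure (S.X × T.X)} (hν : S.IsJoining T ν) :
    IsProbabilityMeasure ν :=
  have : IsProbabilityMeasure (ν.map Prod.fst) := hν.map_fst ▸ S.isProbability
  Measure.isProbabilityMeasure_of_map Prod.fst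

lemma IsJoining.isEquivariantKernel {κ : Kernel T.X S.X} [IsFiniteKernel κ]
    (hκ : T.IsJoining S (T.μ ⊗ₘ κ)) : T.IsEquivariantKernel S κ where
  comp_eq := by rw [← Measure.snd_compProd, Measure.snd, hκ.map_snd]
  equivariant g := ae_map_eq_of_map_prodMap_compProd_eq (e := .smul g) (T.measurePreserving g)
    (measurable_const_smul g) (hκ.invariant g)

lemma IsJoining.exists_compProd_eq {ν : Measure (T.X × S.X)} (hν : T.IsJoining S ν) :
    ∃ κ : Kernel T.X S.X, IsMarkovKernel κ ∧ T.μ ⊗ₘ κ = ν := by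
  have := hν.isProbabilityMeasure
  have := nonempty_of_isProbabilityMeasure S.μ
  refine ⟨ν.condKernel, inferInstance, ?_⟩
  rw [← hν.map_fst]
  exact ν.disintegrate ν.condKernel

end Joining

end MPSystem

theorem mainTheorem4 {G : Type u} [Group G] [Countable G]
    (P : MPSystem.{u, v} G → Prop) (hP : MPSystem.HereditarilyStable P)
    (S T : MPSystem.{u, v} G) (hS : P S) (hT : ¬ P T)
    (hTF : ∀ (𝓐 : MeasurableSpace T.X) (F : MPSystem.{u, v} G),
      T.IsInvariant 𝓐 → T.IsNontrivialOn 𝓐 → F.IsFactorOn T 𝓐 → ¬ P F) :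
    S.Disjoint T := by
  refine MPSystem.Disjoint.symm fun ν hν => ?_
  obtain ⟨κ, _, rfl⟩ := hν.exists_compProd_eq
  have hκ := hν.isEquivariantKernel
  suffices hconst : ∀ A, MeasurableSet A → ∃ c, ∀ᵐ y ∂T.μ, κ y A = c by
    rw [compProd_eq_prod_of_ae_eq_const hconst, hκ.comp_eq]
  intro A hA
  have hA1 : Measurable (A.indicator (1 : S.X → ℝ)) := measurable_one.indicator hA
  have hPF := hP.orbitSystem_integral hS hκ hA1 ((integrable_const 1).indicator hA)
  have hF := MPSystem.isFactorMap_orbitSystem (measurable_integral_kernel κ hA1)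
  obtain ⟨c, hc⟩ := MPSystem.exists_ae_eq_const_of_not_isNontrivialOn hF.isInvariant.le
    (fun hnontriv => hTF _ _ hF.isInvariant hnontriv hF.isFactorOn hPF)
    (MPSystem.measurable_comap_orbitMap _)
  refine ⟨ENNReal.ofReal c, ?_⟩
  filter_upwards [hc] with y hy
  rw [← ofReal_measureReal, ← integral_indicator_one hA, hy, Function.const_apply]
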